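/- Let $G$ be a (finite-dimensional, real) Lie group with Lie algebra $\mathfrak g = T_eG$, whose bracket is that of left-invariant vector fields, and let $\pi : P \to M$ be a smooth principal $G$-bundle: $G$ acts smoothly and freely on $P$ from the right, the fibres of the smooth surjection $\pi$ are the $G$-orbits, and $\pi$ has smooth $G$-equivariant local trivializations $\pi^{-1}(U) \cong U \times G$. For $A \in \mathfrak g$ and $p \in P$ let $A^\sharp_p = \frac{d}{dt}\big|_{t=0}\, p\cdot \exp(tA)$; the map $A \mapsto A^\sharp_p$ is an isomorphism of $\mathfrak g$ onto the vertical space $V_pP = \ker (d\pi)_p$. Let a connection on $P$ be given, that is, a smooth distribution of subspaces $H_pP \subseteq T_pP$ with $T_pP = H_pP \oplus V_pP$ and $(\cdot g)_*(H_pP) = H_{p\cdot g}P$ for all $p \in P$, $g \in G$. Write $X = \mathsf{Hor}(X) + \mathsf{Ver}(X)$ for the resulting decomposition of tangent vectors, and let $\omega$ be the connection one-form, i.e. the $\mathfrak g$-valued one-form on $P$ for which $\omega_p(X)$ is the unique $A \in \mathfrak g$ with $A^\sharp_p = \mathsf{Ver}(X)$. Let $\Omega = D\omega$ be the curvature, i.e.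 the $\mathfrak g$-valued two-form $$\Omega_p(X,Y) = d\omega_p(\mathsf{Hor}(X), \mathsf{Hor}(Y)), \qquad X, Y \in T_pP,$$ where $d$ is the exterior derivative, normalized so that $d\omega(X,Y) = X(\omega(Y)) - Y(\omega(X)) - \omega([X,Y])$ for vector fields $X$, $Y$. Then $$\Omega = d\omega + \omega\wedge\omega, \qquad\text{where } (\omega\wedge\omega)_p(X,Y) := [\omega_p(X), \omega_p(Y)],$$ that is, $\Omega_p(X,Y) = d\omega_p(X,Y) + [\omega_p(X),\omega_p(Y)]$ for all $p \in P$ and $X, Y \in T_pP$. -/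

import Mathlib

open scoped Manifold RightActions

noncomputable section

/-! ### Vector-valued differential forms and the exterior derivative on a manifold -/

/-- A (not necessarily smooth) `F`-valued `k`-form on `M`: an alternating `k`-linear map on every
tangent space. -/
abbrev FormOn {E H : Type*} [NormedAddCommGroup E] [NormedSpace ℝ E] [TopologicalSpace H]
    (I : ModelWithCorners ℝ E H) (M : Type*) [TopologicalSpace M] [ChartedSpace H M]
    (k : ℕ) (F : Type*) [AddCommGroup F] [Module ℝ F] [TopologicalSpace F] : Type _ :=
  ∀ p : M, TangentSpace I p [⋀^Fin k]→L[ℝ] F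

/-- The coordinate expression of the form `φ` in the preferred chart at `p`, that is, the pullback
of `φ` to the model vector space under the inverse of that chart. -/
def FormOn.inChart {E H : Type*} [NormedAddCommGroup E] [NormedSpace ℝ E] [TopologicalSpace H]
    {I : ModelWithCorners ℝ E H} {M : Type*} [TopologicalSpace M] [ChartedSpace H M]
    {k : ℕ} {F : Type*} [AddCommGroup F] [Module ℝ F] [TopologicalSpace F]
    (φ : FormOn I M k F) (p : M) : E → E [⋀^Fin k]→L[ℝ] F := fun y ↦
  (φ ((extChartAt I p).symm y)).compContinuousLinearMap
    (mfderiv 𝓘(ℝ, E) I (extChartAt I p).symm y : E →L[ℝ] TangentSpace I ((extChartAt I p).symm y))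

/-- The exterior derivative `dφ` on a manifold without boundary: at `p` it is computed in the
preferred chart at `p`. The normalization is that of `extDeriv`, so that for a `1`-form
`dφ(X, Y) = X (φ Y) - Y (φ X) - φ [X, Y]`. -/
def FormOn.d {E H : Type*} [NormedAddCommGroup E] [NormedSpace ℝ E] [TopologicalSpace H]
    {I : ModelWithCorners ℝ E H} {M : Type*} [TopologicalSpace M] [ChartedSpace H M]
    {k : ℕ} {F : Type*} [NormedAddCommGroup F] [NormedSpace ℝ F]
    (φ : FormOn I M k F) : FormOn I M (k + 1) F := fun p ↦
  (extDeriv (φ.inChart p) (extChartAt I p p)).compContinuousLinearMap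
    (mfderiv I 𝓘(ℝ, E) (extChartAt I p) p : TangentSpace I p →L[ℝ] E)

section Bundle

variable {EG HG EP HP EM HM : Type*}
  [NormedAddCommGroup EG] [NormedSpace ℝ EG] [TopologicalSpace HG]
  [NormedAddCommGroup EP] [NormedSpace ℝ EP] [TopologicalSpace HP]
  [NormedAddCommGroup EM] [NormedSpace ℝ EM] [TopologicalSpace HM]
  (IG : ModelWithCorners ℝ EG HG) (IP : ModelWithCorners ℝ EP HP) (IM : ModelWithCorners ℝ EM HM)
  {G P M : Type*} [TopologicalSpace G] [ChartedSpace HG G] [Group G]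
  [TopologicalSpace P] [ChartedSpace HP P] [MulAction Gᵐᵒᵖ P]
  [TopologicalSpace M] [ChartedSpace HM M]

/-- `π : P → M` is a smooth principal `G`-bundle for the given right action of `G` on `P`, which is
written `p <• g`: the action is smooth and free, `π` is a smooth surjection whose fibres are exactly
the orbits, and `π` has smooth `G`-equivariant local trivializations `π ⁻¹(U) ≅ U × G`. -/
structure IsPrincipalBundle (π : P → M) : Prop where
  smooth_action : ContMDiff (IP.prod IG) IP (⊤ : ℕ∞) fun q : P × G ↦ q.1 <• q.2
  free : ∀ (p : P) (g : G), p <• g = p → g = 1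
  smooth_proj : ContMDiff IP IM (⊤ : ℕ∞) π
  surjective : Function.Surjective π
  proj_eq_iff : ∀ p q : P, π p = π q ↔ ∃ g : G, q = p <• g
  locally_trivial : ∀ x : M, ∃ e : Bundle.Trivialization G π, x ∈ e.baseSet ∧
    ContMDiffOn IP (IM.prod IG) (⊤ : ℕ∞) e e.source ∧
    ContMDiffOn (IM.prod IG) IP (⊤ : ℕ∞) e.toOpenPartialHomeomorph.symm e.target ∧
    ∀ p ∈ e.source, ∀ g : G, (e (p <• g)).2 = (e p).2 * g

/-- The map `A ↦ A♯` at `p`, from the Lie algebra of `G` to `T_p P`: the derivative at `1` of the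
orbit map `g ↦ p <• g`. So `A♯` at `p` is the velocity at `t = 0` of `t ↦ p <• γ t` for every curve
`γ` in `G` through `1` with velocity `A`, for instance for `γ t = exp (t A)`; see
`hasMFDerivAt_fundamentalField`. -/
def fundamentalField (p : P) : GroupLieAlgebra IG G →L[ℝ] TangentSpace IP p :=
  (mfderiv IG IP (fun g : G ↦ p <• g) 1 : EG →L[ℝ] EP)

theorem hasMFDerivAt_fundamentalField {IG : ModelWithCorners ℝ EG HG}
    {IP : ModelWithCorners ℝ EP HP} {IM : ModelWithCorners ℝ EM HM} {π : P → M}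
    (hπ : IsPrincipalBundle (G := G) IG IP IM π) (p : P) (A : GroupLieAlgebra IG G)
    (γ : ℝ → G) (hγ0 : γ 0 = 1)
    (hγ : HasMFDerivAt 𝓘(ℝ, ℝ) IG γ 0 ((1 : ℝ →L[ℝ] ℝ).smulRight (A : EG) : ℝ →L[ℝ] EG)) :
    HasMFDerivAt 𝓘(ℝ, ℝ) IP (fun t ↦ p <• γ t) 0
      ((1 : ℝ →L[ℝ] ℝ).smulRight (fundamentalField IG IP p A : EP) : ℝ →L[ℝ] EP) := by
  have hF : MDifferentiableAt IG IP (fun g : G ↦ p <• g) (γ 0) :=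
    ((hπ.smooth_action.comp
      (contMDiff_const.prodMk contMDiff_id : ContMDiff IG (IP.prod IG) (⊤ : ℕ∞) fun g : G ↦ (p, g)))
      |>.mdifferentiable (by simp)) (γ 0)
  have h := hF.hasMFDerivAt.comp (0 : ℝ) hγ
  rw [hγ0] at h
  have e : (((mfderiv IG IP (fun g : G ↦ p <• g) 1 : EG →L[ℝ] EP)) ∘L
      ((1 : ℝ →L[ℝ] ℝ).smulRight (A : EG)) : ℝ →L[ℝ] EP) =
      (1 : ℝ →L[ℝ] ℝ).smulRight (fundamentalField IG IP p A : EP) := by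
    ext
    exact (mfderiv IG IP (fun g : G ↦ p <• g) 1 : EG →L[ℝ] EP).map_smul (1 : ℝ) A
  exact h.congr_mfderiv e

/-- The vertical subspace at `p`, the kernel of the derivative of the projection. -/
def verticalSpace (π : P → M) (p : P) : Submodule ℝ (TangentSpace IP p) :=
  (mfderiv IP IM π p).ker

variable {IP IM}

/-- The projection of `T_p P` onto `K` along a complement `L`, as a continuous linear map. -/
def tangentProjection [FiniteDimensional ℝ EP] {p : P} (K L : Submodule ℝ (TangentSpace IP p))
    (h : IsCompl K L) : TangentSpace IP p →L[ℝ] TangentSpace IP p :=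
  haveI : T2Space (TangentSpace IP p) := inferInstanceAs (T2Space EP)
  haveI : FiniteDimensional ℝ (TangentSpace IP p) := inferInstanceAs (FiniteDimensional ℝ EP)
  LinearMap.toContinuousLinearMap (K.projection L h)

variable (IP IM G)

/-- A connection on the bundle `π : P → M`: a smooth distribution of horizontal subspaces
complementary to the vertical ones and invariant under the right translations by elements of `G`.
Smoothness of the distribution says that the projection `TP → TP` of tangent vectors to their
horizontal parts is smooth. -/
structure BundleConnection [FiniteDimensional ℝ EP] [IsManifold IP (⊤ : ℕ∞) P] (π : P → M) where
  horizontalSpace : ∀ p : P, Submodule ℝ (TangentSpace IP p)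
  isCompl : ∀ p, IsCompl (horizontalSpace p) (verticalSpace IP IM π p)
  invariant : ∀ (p : P) (g : G),
    (horizontalSpace p).map (mfderiv IP IP (fun q : P ↦ q <• g) p).toLinearMap =
      horizontalSpace (p <• g)
  smooth : ContMDiff IP.tangent IP.tangent (⊤ : ℕ∞) fun v : TangentBundle IP P ↦
    (⟨v.proj, tangentProjection (horizontalSpace v.proj) (verticalSpace IP IM π v.proj)
      (isCompl v.proj) v.snd⟩ : TangentBundle IP P)

namespace BundleConnection

variable {IG IP IM G}
variable [FiniteDimensional ℝ EP] [IsManifold IP (⊤ : ℕ∞) P] {π : P → M}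

/-- The horizontal part of tangent vectors at `p`. -/
def hor (C : BundleConnection IP IM G π) (p : P) : TangentSpace IP p →L[ℝ] TangentSpace IP p :=
  tangentProjection (C.horizontalSpace p) (verticalSpace IP IM π p) (C.isCompl p)

/-- The vertical part of tangent vectors at `p`. -/
def ver (C : BundleConnection IP IM G π) (p : P) : TangentSpace IP p →L[ℝ] TangentSpace IP p :=
  tangentProjection (verticalSpace IP IM π p) (C.horizontalSpace p) (C.isCompl p).symm

/-- The covariant exterior derivative `Dφ`, the exterior derivative `dφ` evaluated on the
horizontal parts of its arguments. -/
def covariantD (C : BundleConnection IP IM G π) {k : ℕ} {F : Type*} [NormedAddCommGroup F]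
    [NormedSpace ℝ F] (φ : FormOn IP P k F) : FormOn IP P (k + 1) F := fun p ↦
  (φ.d p).compContinuousLinearMap (C.hor p)

/-- `ω` is the connection one-form of `C`: `ω` sends a tangent vector `v` at `p` to the preimage of
the vertical part of `v` under the isomorphism `A ↦ A♯` of the Lie algebra onto the vertical
space at `p`. -/
def IsConnectionForm (C : BundleConnection IP IM G π) (ω : FormOn IP P 1 (GroupLieAlgebra IG G)) :
    Prop :=
  ∀ (p : P) (v : TangentSpace IP p), fundamentalField IG IP p (ω p ![v]) = C.ver p v

/-- The curvature `Ω = Dω` of the connection with connection one-form `ω`. The Lie algebra is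
regarded as a normed space through `EG`, of which it is by definition a copy. -/
def curvature (C : BundleConnection IP IM G π) (ω : FormOn IP P 1 (GroupLieAlgebra IG G)) :
    FormOn IP P 2 (GroupLieAlgebra IG G) :=
  C.covariantD (F := EG) ω

end BundleConnection

variable {IG IP G}

/-- The exterior derivative of a form with values in the Lie algebra of `G`. The Lie algebra is by
definition a copy of the model space `EG`, which carries the norm that `FormOn.d` asks for; in finite
dimension the derivative does not depend on the norm. -/
def lieD {k : ℕ} (ω : FormOn IP P k (GroupLieAlgebra IG G)) :
    FormOn IP P (k + 1) (GroupLieAlgebra IG G) :=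
  FormOn.d (F := EG) ω

/-- The form `ω ∧ ω` given by `(ω ∧ ω)(X, Y) = [ω X, ω Y]`, for a one-form `ω` with values in the Lie
algebra of `G`. -/
def selfWedge [FiniteDimensional ℝ EG] [LieGroup IG (⊤ : ℕ∞) G]
    (ω : FormOn IP P 1 (GroupLieAlgebra IG G)) : FormOn IP P 2 (GroupLieAlgebra IG G) := fun p ↦
  haveI : LieGroup IG (minSmoothness ℝ 3) G := by
    rw [minSmoothness_of_isRCLikeNormedField]; infer_instance
  haveI : CompleteSpace EG := FiniteDimensional.complete ℝ EG
  have hu (x : TangentSpace IP p) : Function.update ![0] 0 x = ![x] := by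
    ext i; fin_cases i; simp
  { toFun := fun X ↦ ⁅ω p ![X 0], ω p ![X 1]⁆
    map_update_add' := by
      intro _ X i x y
      have h (x y : TangentSpace IP p) : ω p ![x + y] = ω p ![x] + ω p ![y] := by
        have := (ω p).map_update_add ![0] 0 x y
        rwa [hu, hu, hu] at this
      fin_cases i <;> simp [Function.update, h]
    map_update_smul' := by
      intro _ X i c x
      have h (x : TangentSpace IP p) : ω p ![c • x] = c • ω p ![x] := by
        have := (ω p).map_update_smul ![0] 0 c x
        rwa [hu, hu] at this
      fin_cases i <;> simp [Function.update, h]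
    map_eq_zero_of_eq' := by
      intro X i j hX hij
      have h : X 0 = X 1 := by
        fin_cases i <;> fin_cases j <;> simp_all
      simp [h]
    cont := by
      have : T2Space (GroupLieAlgebra IG G) := inferInstanceAs (T2Space EG)
      have : FiniteDimensional ℝ (GroupLieAlgebra IG G) :=
        inferInstanceAs (FiniteDimensional ℝ EG)
      have hB : Continuous fun q : GroupLieAlgebra IG G × GroupLieAlgebra IG G ↦ ⁅q.1, q.2⁆ := by
        let B : GroupLieAlgebra IG G →ₗ[ℝ] GroupLieAlgebra IG G →ₗ[ℝ] GroupLieAlgebra IG G :=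
          LinearMap.mk₂ ℝ (fun x y ↦ ⁅x, y⁆) add_lie smul_lie lie_add (fun c x y ↦ lie_smul c x y)
        let B' : EG →L[ℝ] EG →L[ℝ] EG := B.toContinuousBilinearMap
        exact (B'.continuous.comp continuous_fst).clm_apply continuous_snd
      have h (i : Fin 2) : Continuous fun X : Fin 2 → TangentSpace IP p ↦ ω p ![X i] :=
        (ω p).cont.comp (by fun_prop)
      exact hB.comp ((h 0).prodMk (h 1)) }

end Bundle

end

/-!
# The structure equation of a connection on a principal bundle

Write `A♯` for the fundamental vector field of `A`. Both sides of `Ω = dω + ω ∧ ω` are alternating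
and bilinear, and every tangent vector is the sum of a horizontal vector and some `A♯`. The equation
therefore reduces to two evaluations of `dω`: `dω(A♯, B♯) = -[A, B]`
(`extDeriv_lieFormInChart_fundamentalField`), and `dω(X, A♯) = 0` for `X` horizontal
(`extDeriv_lieFormInChart_horizontal_fundamentalField`).

Both are obtained by pulling `ω` back along the action. Let `η` be `ω` read in the preferred chart at
`p`, and let `F(y, z)` be the action of `G` read in the preferred charts at `p` and at `1`. As `d`
commutes with pullback, `dη(DF u, DF v) = u(η(DF v)) - v(η(DF u)) - η(DF [u, v])` for all vector
fields `u`, `v` on the domain of `F` (`extDeriv_apply_fderiv_vectorField`).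

* For the first evaluation restrict `F` to the orbit of `p`, and take for `u` and `v` the
  left-invariant vector fields of `A` and `B`. The orbit map carries them to `A♯` and `B♯`, on which
  `ω` is constant, so only the bracket term survives, and that is the bracket of the Lie algebra.
* For the second take for `u` a constant field in the direction of `P`, with value `X`, and for `v` a
  constant field in the direction of `G`, with value `A`. They commute. Along `z = const`, `η(DF v)`
  is the constant `ω(A♯) = A`; along `y = const`, `η(DF u)` is `ω` of a right translate of `X`, which
  vanishes because the connection is invariant. In this way the derivative of the adjoint
  representation is never needed.

All this presupposes that `η` is differentiable at the point in question
(`differentiableAt_lieFormInChart`). This holds because `ω(X)` is the solution `A` of the equation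
`A♯ = Ver(X)`, where `A ↦ A♯` is injective by local triviality and both sides depend smoothly on the
base point.
-/

open scoped Manifold RightActions
open VectorField Filter Topology

noncomputable section

/-! ### One-forms on vector spaces and their pullbacks -/

section Flat

variable {E E₁ V : Type*} [NormedAddCommGroup E] [NormedSpace ℝ E]
  [NormedAddCommGroup E₁] [NormedSpace ℝ E₁] [NormedAddCommGroup V] [NormedSpace ℝ V]

/-- The formula `dα(u, v) = u(α v) - v(α u) - α [u, v]` for the pullback `α` of `η` along `f`, with
`α` and `dα` expressed by `η` and `dη`. Nothing requires `u` and `v` to descend to vector fields on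
the target of `f`. -/
theorem extDeriv_apply_fderiv_vectorField {η : E → E [⋀^Fin 1]→L[ℝ] V} {f : E₁ → E} {x : E₁}
    (hη : DifferentiableAt ℝ η (f x)) (hf : ContDiffAt ℝ 2 f x) {u v : E₁ → E₁}
    (hu : DifferentiableAt ℝ u x) (hv : DifferentiableAt ℝ v x) :
    extDeriv η (f x) ![fderiv ℝ f x (u x), fderiv ℝ f x (v x)] =
      fderiv ℝ (fun y ↦ η (f y) ![fderiv ℝ f y (v y)]) x (u x) -
        fderiv ℝ (fun y ↦ η (f y) ![fderiv ℝ f y (u y)]) x (v x) -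
        η (f x) ![fderiv ℝ f x (lieBracket ℝ u v x)] := by
  have hpull := extDeriv_pullback (n := 1) (r := 2) hη hf (by simp)
  have hdf : DifferentiableAt ℝ f x := hf.differentiableAt (by simp)
  have hd2f : DifferentiableAt ℝ (fderiv ℝ f) x :=
    (hf.fderiv_right (m := 1) (by norm_num)).differentiableAt (by simp)
  have hpη : DifferentiableAt ℝ
      (fun x ↦ (η (f x)).compContinuousLinearMap (fderiv ℝ f x)) x :=
    (DifferentiableAt.fun_comp' x hη hdf).continuousAlternatingMapCompContinuousLinearMap hd2f
  have h := extDeriv_apply_vectorField (n := 0) (V := ![u, v]) hpη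
    (by intro i; fin_cases i <;> assumption)
  rw [hpull] at h
  have c1 (y : E₁) (w : Fin 1 → E₁) : (fderiv ℝ f y) ∘ w = ![fderiv ℝ f y (w 0)] := by
    ext i; fin_cases i; rfl
  have c2 : (⇑(fderiv ℝ f x) ∘ fun i : Fin 2 ↦ (![u, v] : Fin 2 → E₁ → E₁) i x) =
      ![fderiv ℝ f x (u x), fderiv ℝ f x (v x)] := by
    ext i; fin_cases i <;> rfl
  simp only [ContinuousAlternatingMap.compContinuousLinearMap_apply, c2, c1] at h
  rw [h]
  simp [Fin.sum_univ_succ, Fin.removeNth, sub_eq_add_neg]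

theorem extDeriv_apply_fderiv_of_const {η : E → E [⋀^Fin 1]→L[ℝ] V} {f : E₁ → E} {x : E₁}
    (hη : DifferentiableAt ℝ η (f x)) (hf : ContDiffAt ℝ 2 f x) {u v : E₁ → E₁}
    (hu : DifferentiableAt ℝ u x) (hv : DifferentiableAt ℝ v x) {a b : V}
    (ha : ∀ᶠ y in 𝓝 x, η (f y) ![fderiv ℝ f y (u y)] = a)
    (hb : ∀ᶠ y in 𝓝 x, η (f y) ![fderiv ℝ f y (v y)] = b) :
    extDeriv η (f x) ![fderiv ℝ f x (u x), fderiv ℝ f x (v x)] =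
      -η (f x) ![fderiv ℝ f x (lieBracket ℝ u v x)] := by
  rw [extDeriv_apply_fderiv_vectorField hη hf hu hv]
  have h1 := Filter.EventuallyEq.fderiv_eq (𝕜 := ℝ) (f₁ := fun y ↦ η (f y) ![fderiv ℝ f y (u y)])
    (f := fun _ ↦ a) ha
  have h2 := Filter.EventuallyEq.fderiv_eq (𝕜 := ℝ) (f₁ := fun y ↦ η (f y) ![fderiv ℝ f y (v y)])
    (f := fun _ ↦ b) hb
  rw [h1, h2]
  simp

theorem differentiableAt_oneForm_apply_fderiv {η : E → E [⋀^Fin 1]→L[ℝ] V} {f : E₁ → E} {x : E₁}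
    (hη : DifferentiableAt ℝ η (f x)) (hf : ContDiffAt ℝ 2 f x) (w : E₁) :
    DifferentiableAt ℝ (fun y ↦ η (f y) ![fderiv ℝ f y w]) x := by
  have hdf : DifferentiableAt ℝ f x := hf.differentiableAt (by simp)
  have hd2f : DifferentiableAt ℝ (fderiv ℝ f) x :=
    (hf.fderiv_right (m := 1) (by norm_num)).differentiableAt (by simp)
  refine DifferentiableAt.continuousAlternatingMap_apply
    (DifferentiableAt.fun_comp' x hη hdf) fun i ↦ ?_
  fin_cases i
  simpa using hd2f.clm_apply (differentiableAt_const w)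

/-- The constant fields `(u, 0)` and `(0, w)` commute, and the two remaining terms of `dη` are the
derivative of `η(DF(0, w))` along the first factor and that of `η(DF(u, 0))` along the second. So
constancy of these functions along a single slice through `(x, z)` each is enough. -/
theorem extDeriv_apply_fderiv_prod {η : E → E [⋀^Fin 1]→L[ℝ] V} {F : E × E₁ → E} {x : E} {z : E₁}
    (hη : DifferentiableAt ℝ η (F (x, z))) (hF : ContDiffAt ℝ 2 F (x, z)) {u : E} {w : E₁}
    {a b : V}
    (ha : ∀ᶠ t in 𝓝 z, η (F (x, t)) ![fderiv ℝ F (x, t) (u, 0)] = a)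
    (hb : ∀ᶠ y in 𝓝 x, η (F (y, z)) ![fderiv ℝ F (y, z) (0, w)] = b) :
    extDeriv η (F (x, z)) ![fderiv ℝ F (x, z) (u, 0), fderiv ℝ F (x, z) (0, w)] = 0 := by
  have key := extDeriv_apply_fderiv_vectorField hη hF (u := fun _ ↦ (u, 0)) (v := fun _ ↦ (0, w))
    (differentiableAt_const _) (differentiableAt_const _)
  have h1 : fderiv ℝ (fun y ↦ η (F y) ![fderiv ℝ F y (0, w)]) (x, z) (u, 0) = 0 := by
    have h := (differentiableAt_oneForm_apply_fderiv hη hF (0, w)).hasFDerivAt.comp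
      (f := fun y ↦ (y, z)) x (hasFDerivAt_prodMk_left x z)
    have h' := h.unique ((hasFDerivAt_const b x).congr_of_eventuallyEq hb)
    simpa using DFunLike.congr_fun h' u
  have h2 : fderiv ℝ (fun y ↦ η (F y) ![fderiv ℝ F y (u, 0)]) (x, z) (0, w) = 0 := by
    have h := (differentiableAt_oneForm_apply_fderiv hη hF (u, 0)).hasFDerivAt.comp
      (f := fun t ↦ (x, t)) z (hasFDerivAt_prodMk_right x z)
    have h' := h.unique ((hasFDerivAt_const a z).congr_of_eventuallyEq ha)
    simpa using DFunLike.congr_fun h' w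
  rw [key, h1, h2]
  have h0 : (![0] : Fin 1 → E) = 0 := by ext i; fin_cases i; rfl
  simp [lieBracket, h0]

/-- A one-form `η` given implicitly by an equation `K (η v) = T v` is differentiable where `K` is
injective, provided that `K` and `T` depend differentiably on the point. -/
theorem differentiableAt_oneForm_of_comp_eq [FiniteDimensional ℝ E] [FiniteDimensional ℝ V]
    {η : E → E [⋀^Fin 1]→L[ℝ] V} {K : E → V →L[ℝ] E} {T : E → E → E} {x : E}
    (hK : DifferentiableAt ℝ K x) (hinj : Function.Injective (K x))
    (hT : ∀ v, DifferentiableAt ℝ (fun y ↦ T y v) x)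
    (h : ∀ᶠ y in 𝓝 x, ∀ v, K y (η y ![v]) = T y v) : DifferentiableAt ℝ η x := by
  have : CompleteSpace V := FiniteDimensional.complete ℝ V
  obtain ⟨g, hg⟩ := LinearMap.exists_leftInverse_of_injective (K x).toLinearMap
    (LinearMap.ker_eq_bot.2 hinj)
  -- Composed with a left inverse `l` of `K x`, the equation becomes solvable for `η` near `x`.
  let l : E →L[ℝ] V := LinearMap.toContinuousLinearMap g
  have hl : l ∘L K x = ContinuousLinearMap.id ℝ V := by
    ext v; exact LinearMap.congr_fun hg v
  let N : E → V →L[ℝ] V := fun y ↦ l ∘L K y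
  have hN : DifferentiableAt ℝ N x := (differentiableAt_const l).clm_comp hK
  have hNx : N x = 1 := hl
  have hunit : ∀ᶠ y in 𝓝 x, IsUnit (N y) := by
    have : {m : V →L[ℝ] V | IsUnit m} ∈ 𝓝 (N x) :=
      Units.isOpen.mem_nhds (by rw [hNx]; exact isUnit_one)
    exact hN.continuousAt this
  have hinv : DifferentiableAt ℝ (fun y ↦ Ring.inverse (N y)) x := by
    refine DifferentiableAt.fun_comp' x ?_ hN
    rw [hNx]
    exact differentiableAt_inverse (𝕜 := ℝ) (R := V →L[ℝ] V) isUnit_one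
  have hv (v : E) : DifferentiableAt ℝ (fun y ↦ η y ![v]) x := by
    refine (hinv.clm_apply ((differentiableAt_const l).clm_apply (hT v))).congr_of_eventuallyEq ?_
    filter_upwards [h, hunit] with y hy hu
    rw [← hy v]
    have := Ring.inverse_mul_cancel _ hu
    exact (DFunLike.congr_fun this (η y ![v])).symm
  let b := Module.finBasis ℝ E
  -- A one-form is determined by its values on a basis, through a linear map defined on a
  -- finite-dimensional space.
  let ev : E [⋀^Fin 1]→L[ℝ] V →ₗ[ℝ] (Fin (Module.finrank ℝ E) → V) :=
    { toFun := fun α i ↦ α ![b i]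
      map_add' := fun _ _ ↦ rfl
      map_smul' := fun _ _ ↦ rfl }
  have hev : LinearMap.ker ev = ⊥ := by
    refine LinearMap.ker_eq_bot'.2 fun α hα ↦ ?_
    refine ContinuousAlternatingMap.toAlternatingMap_injective ?_
    refine Module.Basis.ext_alternating b fun c _ ↦ ?_
    have e1 : (fun i ↦ b (c i)) = ![b (c 0)] := by
      ext i; fin_cases i; rfl
    rw [e1]
    exact congrFun hα (c 0)
  obtain ⟨r, hr⟩ := LinearMap.exists_leftInverse_of_injective ev hev
  have h1 : DifferentiableAt ℝ (fun y ↦ ev (η y)) x :=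
    differentiableAt_pi.2 fun i ↦ hv (b i)
  have h2 : DifferentiableAt ℝ (fun y ↦ r (ev (η y))) x :=
    (LinearMap.toContinuousLinearMap r).differentiableAt.comp x h1
  exact h2.congr_of_eventuallyEq (Eventually.of_forall fun y ↦ (LinearMap.congr_fun hr (η y)).symm)

end Flat

theorem ContinuousAlternatingMap.apply_add_add {E V : Type*} [AddCommGroup E] [Module ℝ E]
    [TopologicalSpace E] [AddCommGroup V] [Module ℝ V] [TopologicalSpace V]
    (f : E [⋀^Fin 2]→L[ℝ] V) (a b c d : E) :
    f ![a + b, c + d] = f ![a, c] + f ![a, d] - f ![c, b] + f ![b, d] := by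
  have h1 (x y z : E) : f ![x + y, z] = f ![x, z] + f ![y, z] := f.vecCons_add ![z] x y
  have h3 (x y : E) : f ![x, y] = -f ![y, x] := by
    have := f.toAlternatingMap.map_swap ![y, x] (show (0 : Fin 2) ≠ 1 by simp)
    refine Eq.trans ?_ this
    refine congrArg f ?_
    ext i; fin_cases i <;> rfl
  have h2 (x y z : E) : f ![z, x + y] = f ![z, x] + f ![z, y] := by
    rw [h3 z, h1, h3 z x, h3 z y, neg_add]
  rw [h1, h2, h2, h3 b c]
  abel

/-! ### Derivatives of preferred charts on manifolds without boundary -/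

section Charts

variable {EP HP P V : Type*}
  [NormedAddCommGroup EP] [NormedSpace ℝ EP] [TopologicalSpace HP]
  {IP : ModelWithCorners ℝ EP HP} [TopologicalSpace P] [ChartedSpace HP P]
  [IsManifold IP (⊤ : ℕ∞) P]

/-- The tangent space at `p` is by definition a copy of the model space, identified with it through
the preferred chart at `p`. -/
theorem mfderiv_extChartAt_self_apply (p : P) (v : TangentSpace IP p) :
    (mfderiv IP 𝓘(ℝ, EP) (extChartAt IP p) p : EP →L[ℝ] EP) v = v :=
  DFunLike.congr_fun (mfderiv_extChartAt_self (I := IP) (x := p)) v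

variable [IP.Boundaryless]

theorem contMDiffAt_extChartAt_symm (p : P) {y : EP}
    (hy : y ∈ (extChartAt IP p).target) :
    ContMDiffAt 𝓘(ℝ, EP) IP (⊤ : ℕ∞) (extChartAt IP p).symm y :=
  (contMDiffOn_extChartAt_symm p).contMDiffAt ((isOpen_extChartAt_target p).mem_nhds hy)

theorem hasMFDerivAt_extChartAt_symm (p : P) {y : EP}
    (hy : y ∈ (extChartAt IP p).target) :
    HasMFDerivAt 𝓘(ℝ, EP) IP (extChartAt IP p).symm y
      (mfderiv 𝓘(ℝ, EP) IP (extChartAt IP p).symm y) := by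
  have h := mdifferentiableWithinAt_extChartAt_symm (I := IP) hy
  rw [IP.range_eq_univ, mdifferentiableWithinAt_univ] at h
  exact h.hasMFDerivAt

theorem mfderiv_extChartAt_symm_apply_mfderiv_extChartAt {p q : P}
    (hq : q ∈ (extChartAt IP p).source) (v : TangentSpace IP q) :
    (mfderiv 𝓘(ℝ, EP) IP (extChartAt IP p).symm (extChartAt IP p q) : EP →L[ℝ] EP)
      ((mfderiv IP 𝓘(ℝ, EP) (extChartAt IP p) q : EP →L[ℝ] EP) v) = v := by
  have h := mfderivWithin_extChartAt_symm_comp_mfderiv_extChartAt' (I := IP) hq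
  rw [IP.range_eq_univ, mfderivWithin_univ] at h
  exact DFunLike.congr_fun h v

theorem mfderiv_extChartAt_symm_self (p : P) (v : EP) :
    (mfderiv 𝓘(ℝ, EP) IP (extChartAt IP p).symm (extChartAt IP p p) : EP →L[ℝ] EP) v = v := by
  have h := mfderivWithin_range_extChartAt_symm (I := IP) (x := p)
  rw [IP.range_eq_univ, mfderivWithin_univ] at h
  exact DFunLike.congr_fun h v

variable [NormedAddCommGroup V] [NormedSpace ℝ V]

theorem FormOn.inChart_extChartAt_apply (ω : FormOn IP P 1 V) {p q : P}
    (hq : q ∈ (extChartAt IP p).source) (v : TangentSpace IP q) :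
    ω.inChart p (extChartAt IP p q)
      ![(mfderiv IP 𝓘(ℝ, EP) (extChartAt IP p) q : EP →L[ℝ] EP) v] = ω q ![v] := by
  have h := mfderiv_extChartAt_symm_apply_mfderiv_extChartAt hq v
  have h1 : ω.inChart p (extChartAt IP p q)
      ![(mfderiv IP 𝓘(ℝ, EP) (extChartAt IP p) q : EP →L[ℝ] EP) v] =
      (ω ((extChartAt IP p).symm (extChartAt IP p q)) : EP [⋀^Fin 1]→L[ℝ] V)
      ![(mfderiv 𝓘(ℝ, EP) IP (extChartAt IP p).symm (extChartAt IP p q) : EP →L[ℝ] EP)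
      ((mfderiv IP 𝓘(ℝ, EP) (extChartAt IP p) q : EP →L[ℝ] EP) v)] := by
    refine congrArg (ω ((extChartAt IP p).symm (extChartAt IP p q)) : EP [⋀^Fin 1]→L[ℝ] V) ?_
    ext i; fin_cases i; rfl
  rw [h1, h]
  rw [(extChartAt IP p).left_inv hq]

end Charts

/-! ### Left-invariant vector fields in the chart at the identity -/

section LeftInvariant

variable {EG HG : Type*}
  [NormedAddCommGroup EG] [NormedSpace ℝ EG] [TopologicalSpace HG]
  {IG : ModelWithCorners ℝ EG HG} {G : Type*} [TopologicalSpace G] [ChartedSpace HG G] [Group G]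

variable (IG G) in
/-- The left-invariant vector field with value `A` at `1`, read in the preferred chart at `1`. -/
def leftInvariantInChart (A : GroupLieAlgebra IG G) : EG → EG :=
  mpullbackWithin 𝓘(ℝ, EG) IG (extChartAt IG (1 : G)).symm (mulInvariantVectorField A)
    (Set.range IG)

variable [IG.Boundaryless] [LieGroup IG (⊤ : ℕ∞) G]

theorem mfderiv_extChartAt_symm_leftInvariantInChart (A : GroupLieAlgebra IG G) {z : EG}
    (hz : z ∈ (extChartAt IG (1 : G)).target) :
    (mfderiv 𝓘(ℝ, EG) IG (extChartAt IG (1 : G)).symm z : EG →L[ℝ] EG)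
      (leftInvariantInChart IG G A z : EG) =
      mulInvariantVectorField A ((extChartAt IG (1 : G)).symm z) := by
  have h2 : mfderivWithin 𝓘(ℝ, EG) IG (extChartAt IG (1 : G)).symm (Set.range IG) z =
      mfderiv 𝓘(ℝ, EG) IG (extChartAt IG (1 : G)).symm z := by
    rw [IG.range_eq_univ, mfderivWithin_univ]
  have h : ContinuousLinearMap.IsInvertible
      (mfderiv 𝓘(ℝ, EG) IG (extChartAt IG (1 : G)).symm z : EG →L[ℝ] EG) := by
    rw [← h2]; exact isInvertible_mfderivWithin_extChartAt_symm (I := IG) hz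
  have h3 : leftInvariantInChart IG G A z =
      (mfderiv 𝓘(ℝ, EG) IG (extChartAt IG (1 : G)).symm z : EG →L[ℝ] EG).inverse
        (mulInvariantVectorField A ((extChartAt IG (1 : G)).symm z)) := by
    rw [← h2]; rfl
  obtain ⟨M, hM⟩ := h
  rw [h3, ← hM, ContinuousLinearMap.inverse_equiv]
  exact M.apply_symm_apply _

theorem leftInvariantInChart_self (A : GroupLieAlgebra IG G) :
    leftInvariantInChart IG G A (extChartAt IG (1 : G) 1) = A := by
  have h := mfderiv_extChartAt_symm_leftInvariantInChart A (mem_extChartAt_target (I := IG) (1 : G))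
  rw [mfderiv_extChartAt_symm_self] at h
  rw [h, extChartAt_to_inv]
  have e : (fun g : G ↦ 1 * g) = id := by ext; simp
  have h1 : (mfderiv IG IG (fun g : G ↦ 1 * g) 1 : EG →L[ℝ] EG) A = A := by
    rw [e]; exact DFunLike.congr_fun (mfderiv_id (I := IG) (x := (1 : G))) A
  exact h1

theorem bracket_eq_lieBracket_leftInvariantInChart (A B : GroupLieAlgebra IG G) :
    ⁅A, B⁆ = lieBracket ℝ (leftInvariantInChart IG G A) (leftInvariantInChart IG G B)
      (extChartAt IG (1 : G) 1) := by
  rw [GroupLieAlgebra.bracket_def, ← mlieBracketWithin_univ, mlieBracketWithin_apply,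
    mfderiv_extChartAt_self]
  rw [← lieBracketWithin_univ]
  have : (extChartAt IG (1 : G)).symm ⁻¹' Set.univ ∩ Set.range IG = Set.univ := by
    rw [Set.preimage_univ, Set.univ_inter, IG.range_eq_univ]
  rw [this]
  have h := ContinuousLinearMap.inverse_id (R := ℝ) (M := EG)
  exact DFunLike.congr_fun h _

theorem differentiableAt_leftInvariantInChart [FiniteDimensional ℝ EG] (A : GroupLieAlgebra IG G) :
    DifferentiableAt ℝ (leftInvariantInChart IG G A) (extChartAt IG (1 : G) 1) := by
  have : LieGroup IG (minSmoothness ℝ 3) G := by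
    rw [minSmoothness_of_isRCLikeNormedField]; infer_instance
  have : CompleteSpace EG := FiniteDimensional.complete ℝ EG
  have h := (mdifferentiableAt_mulInvariantVectorField A (g := (1 : G)))
  rw [← mdifferentiableWithinAt_univ] at h
  have h' := h.differentiableWithinAt_mpullbackWithin_vectorField
  rw [Set.preimage_univ, Set.univ_inter, IG.range_eq_univ] at h'
  rw [leftInvariantInChart, IG.range_eq_univ]
  exact differentiableWithinAt_univ.1 h'

end LeftInvariant

/-! ### Orbits and fundamental vector fields -/

section Bundle

variable {EG HG EP HP EM HM : Type*}
  [NormedAddCommGroup EG] [NormedSpace ℝ EG] [TopologicalSpace HG]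
  [NormedAddCommGroup EP] [NormedSpace ℝ EP] [TopologicalSpace HP]
  [NormedAddCommGroup EM] [NormedSpace ℝ EM] [TopologicalSpace HM]
  {IG : ModelWithCorners ℝ EG HG} {IP : ModelWithCorners ℝ EP HP} {IM : ModelWithCorners ℝ EM HM}
  {G P M : Type*} [TopologicalSpace G] [ChartedSpace HG G] [Group G]
  [TopologicalSpace P] [ChartedSpace HP P]
  [TopologicalSpace M] [ChartedSpace HM M] {π : P → M}

section Orbit

variable [MulAction Gᵐᵒᵖ P]

namespace IsPrincipalBundle

theorem smooth_orbitMap (hπ : IsPrincipalBundle (G := G) IG IP IM π) (p : P) :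
    ContMDiff IG IP (⊤ : ℕ∞) fun g : G ↦ p <• g :=
  hπ.smooth_action.comp
    (contMDiff_const.prodMk contMDiff_id : ContMDiff IG (IP.prod IG) (⊤ : ℕ∞) fun g : G ↦ (p, g))

theorem smooth_translation (hπ : IsPrincipalBundle (G := G) IG IP IM π) (g : G) :
    ContMDiff IP IP (⊤ : ℕ∞) fun p : P ↦ p <• g :=
  hπ.smooth_action.comp
    (contMDiff_id.prodMk contMDiff_const : ContMDiff IP (IP.prod IG) (⊤ : ℕ∞) fun p : P ↦ (p, g))

theorem mdifferentiable_orbitMap (hπ : IsPrincipalBundle (G := G) IG IP IM π) (p : P) :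
    MDifferentiable IG IP fun g : G ↦ p <• g := (hπ.smooth_orbitMap p).mdifferentiable (by simp)

theorem mdifferentiable_translation (hπ : IsPrincipalBundle (G := G) IG IP IM π) (g : G) :
    MDifferentiable IP IP fun p : P ↦ p <• g := (hπ.smooth_translation g).mdifferentiable (by simp)

/-- The orbit map of `p` carries the left-invariant vector field of `A` to the fundamental vector
field `A♯`, because it intertwines left multiplication on `G` with a change of base point on the
orbit. -/
theorem mfderiv_orbitMap_mulInvariantVectorField [LieGroup IG (⊤ : ℕ∞) G]
    (hπ : IsPrincipalBundle (G := G) IG IP IM π)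
    (p : P) (g : G) (A : GroupLieAlgebra IG G) :
    (mfderiv IG IP (fun h : G ↦ p <• h) g : EG →L[ℝ] EP) (mulInvariantVectorField A g) =
      fundamentalField IG IP (p <• g) A := by
  have h1 : HasMFDerivAt IG IG (fun h : G ↦ g * h) 1 (mfderiv IG IG (fun h : G ↦ g * h) 1) :=
    ((contMDiff_mul_left (n := ((⊤ : ℕ∞) : WithTop ℕ∞))).mdifferentiable (by simp) 1).hasMFDerivAt
  have h2 := (hπ.mdifferentiable_orbitMap p (g * 1)).hasMFDerivAt.comp (1 : G) h1
  have e : (fun h : G ↦ p <• h) ∘ (fun h : G ↦ g * h) = fun h : G ↦ (p <• g) <• h := by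
    ext h; simp [mul_smul]
  rw [e] at h2
  have h3 := h2.mfderiv
  have h4 : (fundamentalField IG IP (p <• g) A : EP) =
      (mfderiv IG IP (fun h : G ↦ p <• h) (g * 1) : EG →L[ℝ] EP)
        ((mfderiv IG IG (fun h : G ↦ g * h) 1 : EG →L[ℝ] EG) A) := DFunLike.congr_fun h3 A
  rw [mul_one] at h4
  exact h4.symm

theorem proj_smul (hπ : IsPrincipalBundle (G := G) IG IP IM π) (p : P) (g : G) : π (p <• g) = π p :=
  ((hπ.proj_eq_iff _ _).2 ⟨g, rfl⟩).symm

theorem fundamentalField_mem_verticalSpace (hπ : IsPrincipalBundle (G := G) IG IP IM π) (p : P)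
    (A : GroupLieAlgebra IG G) : fundamentalField IG IP p A ∈ verticalSpace IP IM π p := by
  have h2 := (hπ.smooth_proj.mdifferentiable (by simp) (p <• (1 : G))).hasMFDerivAt.comp (1 : G)
    (hπ.mdifferentiable_orbitMap p 1).hasMFDerivAt
  have e : π ∘ (fun h : G ↦ p <• h) = fun _ ↦ π p := funext fun g ↦ hπ.proj_smul p g
  rw [e] at h2
  have h3 := DFunLike.congr_fun (h2.mfderiv.symm.trans mfderiv_const) A
  have h4 : (mfderiv IP IM π (p <• (1 : G)) : EP →L[ℝ] EM)
    ((mfderiv IG IP (fun h : G ↦ p <• h) 1 : EG →L[ℝ] EP) A) = 0 := h3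
  rw [show p <• (1 : G) = p by simp] at h4
  exact h4

theorem fundamentalField_injective [LieGroup IG (⊤ : ℕ∞) G] [IsManifold IM (⊤ : ℕ∞) M]
    (hπ : IsPrincipalBundle (G := G) IG IP IM π) (p : P) :
    Function.Injective (fundamentalField (G := G) IG IP p) := by
  obtain ⟨e, hx, he, -, heq⟩ := hπ.locally_trivial (π p)
  have hp : p ∈ e.source := e.mem_source.2 hx
  -- In a trivialization `e`, the orbit map has the smooth left inverse `q ↦ (e p).2⁻¹ * (e q).2`.
  let r : P → G := fun q ↦ (e p).2⁻¹ * (e q).2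
  have hr : MDifferentiableAt IP IG r (p <• (1 : G)) := by
    have h0 : p <• (1 : G) = p := by simp
    have h1 : ContMDiffAt IP (IM.prod IG) (⊤ : ℕ∞) e (p <• (1 : G)) := by
      rw [h0]; exact he.contMDiffAt (e.open_source.mem_nhds hp)
    exact (ContMDiffAt.mul contMDiffAt_const h1.snd).mdifferentiableAt (by simp)
  have h2 := hr.hasMFDerivAt.comp (1 : G) (hπ.mdifferentiable_orbitMap p 1).hasMFDerivAt
  have e : r ∘ (fun h : G ↦ p <• h) = id := by
    ext g
    simp [r, heq p hp g]
  rw [e] at h2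
  intro A B hAB
  have h3 := h2.mfderiv.symm.trans mfderiv_id
  have h4 (A : EG) : (mfderiv IP IG r (p <• (1 : G)) : EP →L[ℝ] EG)
    ((mfderiv IG IP (fun h : G ↦ p <• h) 1 : EG →L[ℝ] EP) A) = A := DFunLike.congr_fun h3 A
  rw [← h4 A, ← h4 B]
  exact congrArg (mfderiv IP IG r (p <• (1 : G)) : EP →L[ℝ] EG) hAB

end IsPrincipalBundle

/-! ### The action in charts -/

variable (IG IP G) in
/-- The right action of `G` on `P`, read in the preferred charts at `p` and at `1`. -/
def actionInChart (p : P) (x : EP × EG) : EP :=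
  extChartAt IP p ((extChartAt IP p).symm x.1 <• (extChartAt IG (1 : G)).symm x.2)

variable (IG IP G) in
/-- The set of all `(y, z)` at which `actionInChart` represents the action: `y` and `z` lie in the
targets of the charts, and the translated point lies in the domain of the chart at `p`. Outside of
this set the values of `actionInChart` are junk. -/
def actionDomain (p : P) : Set (EP × EG) :=
  {x | x.1 ∈ (extChartAt IP p).target ∧ x.2 ∈ (extChartAt IG (1 : G)).target ∧
    (extChartAt IP p).symm x.1 <• (extChartAt IG (1 : G)).symm x.2 ∈ (extChartAt IP p).source}

theorem base_mem_actionDomain (p : P) :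
    (extChartAt IP p p, extChartAt IG (1 : G) 1) ∈ actionDomain IG IP G p := by
  refine ⟨by simp, by simp, ?_⟩
  simp

theorem actionInChart_base (p : P) :
    actionInChart IG IP G p (extChartAt IP p p, extChartAt IG (1 : G) 1) = extChartAt IP p p := by
  simp [actionInChart]

variable [IsManifold IP (⊤ : ℕ∞) P] [LieGroup IG (⊤ : ℕ∞) G] [IG.Boundaryless] [IP.Boundaryless]

theorem smooth_action_symm (hπ : IsPrincipalBundle (G := G) IG IP IM π) (p : P) {x : EP × EG}
    (hy : x.1 ∈ (extChartAt IP p).target) (hz : x.2 ∈ (extChartAt IG (1 : G)).target) :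
    ContMDiffAt 𝓘(ℝ, EP × EG) IP (⊤ : ℕ∞) (fun x : EP × EG ↦
      (extChartAt IP p).symm x.1 <• (extChartAt IG (1 : G)).symm x.2) x := by
  have h1 : ContMDiffAt 𝓘(ℝ, EP × EG) IP (⊤ : ℕ∞)
      (fun x : EP × EG ↦ (extChartAt IP p).symm x.1) x :=
    (contMDiffAt_extChartAt_symm p hy).comp x contDiff_fst.contMDiff.contMDiffAt
  have h2 : ContMDiffAt 𝓘(ℝ, EP × EG) IG (⊤ : ℕ∞)
      (fun x : EP × EG ↦ (extChartAt IG (1 : G)).symm x.2) x :=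
    (contMDiffAt_extChartAt_symm (1 : G) hz).comp x contDiff_snd.contMDiff.contMDiffAt
  exact (hπ.smooth_action _).comp x (h1.prodMk h2)

theorem contDiffAt_actionInChart (hπ : IsPrincipalBundle (G := G) IG IP IM π) {p : P} {x : EP × EG}
    (hx : x ∈ actionDomain IG IP G p) : ContDiffAt ℝ (⊤ : ℕ∞) (actionInChart IG IP G p) x := by
  obtain ⟨hy, hz, hs⟩ := hx
  have h3 : ContMDiffAt IP 𝓘(ℝ, EP) (⊤ : ℕ∞) (extChartAt IP p)
      ((extChartAt IP p).symm x.1 <• (extChartAt IG (1 : G)).symm x.2) :=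
    contMDiffAt_extChartAt' (by simpa using hs)
  exact (h3.comp x (smooth_action_symm hπ p hy hz)).contDiffAt

theorem actionDomain_mem_nhds (hπ : IsPrincipalBundle (G := G) IG IP IM π) {p : P} {x : EP × EG}
    (hx : x ∈ actionDomain IG IP G p) : actionDomain IG IP G p ∈ 𝓝 x := by
  obtain ⟨hy, hz, hs⟩ := hx
  filter_upwards [continuous_fst.continuousAt ((isOpen_extChartAt_target p).mem_nhds hy),
    continuous_snd.continuousAt ((isOpen_extChartAt_target (1 : G)).mem_nhds hz),
    (smooth_action_symm hπ p hy hz).continuousAt ((isOpen_extChartAt_source p).mem_nhds hs)]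
    with w h1 h2 h3 using ⟨h1, h2, h3⟩

theorem eventually_left_mem_actionDomain (hπ : IsPrincipalBundle (G := G) IG IP IM π) (p : P) :
    ∀ᶠ y in 𝓝 (extChartAt IP p p), (y, extChartAt IG (1 : G) 1) ∈ actionDomain IG IP G p :=
  (Continuous.prodMk_left (extChartAt IG (1 : G) 1)).continuousAt.eventually_mem
    (actionDomain_mem_nhds hπ (base_mem_actionDomain p))

theorem eventually_right_mem_actionDomain (hπ : IsPrincipalBundle (G := G) IG IP IM π) (p : P) :
    ∀ᶠ z in 𝓝 (extChartAt IG (1 : G) 1), (extChartAt IP p p, z) ∈ actionDomain IG IP G p :=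
  (Continuous.prodMk_right (extChartAt IP p p)).continuousAt.eventually_mem
    (actionDomain_mem_nhds hπ (base_mem_actionDomain p))

theorem fderiv_actionInChart_inl (hπ : IsPrincipalBundle (G := G) IG IP IM π) {p : P} {y : EP}
    {z : EG} (hx : (y, z) ∈ actionDomain IG IP G p) (v : EP) :
    fderiv ℝ (actionInChart IG IP G p) (y, z) (v, 0) =
      (mfderiv IP 𝓘(ℝ, EP) (extChartAt IP p)
        ((extChartAt IP p).symm y <• (extChartAt IG (1 : G)).symm z) : EP →L[ℝ] EP)
      ((mfderiv IP IP (fun q : P ↦ q <• (extChartAt IG (1 : G)).symm z)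
        ((extChartAt IP p).symm y) : EP →L[ℝ] EP)
      ((mfderiv 𝓘(ℝ, EP) IP (extChartAt IP p).symm y : EP →L[ℝ] EP) v)) := by
  have hd := ((contDiffAt_actionInChart hπ hx).differentiableAt (by simp)).hasFDerivAt.comp
    (f := fun y ↦ (y, z)) y (hasFDerivAt_prodMk_left y z)
  obtain ⟨hy, hz, hs⟩ := hx
  have h := ((mdifferentiableAt_extChartAt (by simpa using hs)).hasMFDerivAt.comp _
    (hπ.mdifferentiable_translation _ _).hasMFDerivAt).comp y (hasMFDerivAt_extChartAt_symm p hy)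
  have h' := h.hasFDerivAt
  exact DFunLike.congr_fun (hd.unique h') v

theorem fderiv_actionInChart_inr (hπ : IsPrincipalBundle (G := G) IG IP IM π) {p : P} {y : EP}
    {z : EG} (hx : (y, z) ∈ actionDomain IG IP G p) (w : EG) :
    fderiv ℝ (actionInChart IG IP G p) (y, z) (0, w) =
      (mfderiv IP 𝓘(ℝ, EP) (extChartAt IP p)
        ((extChartAt IP p).symm y <• (extChartAt IG (1 : G)).symm z) : EP →L[ℝ] EP)
      ((mfderiv IG IP (fun g : G ↦ (extChartAt IP p).symm y <• g)
        ((extChartAt IG (1 : G)).symm z) : EG →L[ℝ] EP)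
      ((mfderiv 𝓘(ℝ, EG) IG (extChartAt IG (1 : G)).symm z : EG →L[ℝ] EG) w)) := by
  have hd := ((contDiffAt_actionInChart hπ hx).differentiableAt (by simp)).hasFDerivAt.comp
    (f := fun z ↦ (y, z)) z (hasFDerivAt_prodMk_right y z)
  obtain ⟨hy, hz, hs⟩ := hx
  have h := ((mdifferentiableAt_extChartAt (by simpa using hs)).hasMFDerivAt.comp _
    (hπ.mdifferentiable_orbitMap _ _).hasMFDerivAt).comp z (hasMFDerivAt_extChartAt_symm (1 : G) hz)
  have h' := h.hasFDerivAt
  exact DFunLike.congr_fun (hd.unique h') w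

theorem fderiv_actionInChart_inl_base (hπ : IsPrincipalBundle (G := G) IG IP IM π) (p : P)
    (v : EP) :
    fderiv ℝ (actionInChart IG IP G p) (extChartAt IP p p, extChartAt IG (1 : G) 1) (v, 0) = v := by
  have h := fderiv_actionInChart_inl hπ (base_mem_actionDomain p) v
  rw [mfderiv_extChartAt_symm_self, extChartAt_to_inv, extChartAt_to_inv] at h
  have h1 : p <• (1 : G) = p := by simp
  have h2 : (fun q : P ↦ q <• (1 : G)) = id := by ext; simp
  rw [h1, h2, mfderiv_extChartAt_self_apply] at h
  exact h.trans (DFunLike.congr_fun (mfderiv_id (I := IP) (x := p)) v)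

theorem fderiv_actionInChart_inr_one (hπ : IsPrincipalBundle (G := G) IG IP IM π) {p : P} {y : EP}
    (hx : (y, extChartAt IG (1 : G) 1) ∈ actionDomain IG IP G p) (A : GroupLieAlgebra IG G) :
    fderiv ℝ (actionInChart IG IP G p) (y, extChartAt IG (1 : G) 1) (0, A) =
      (mfderiv IP 𝓘(ℝ, EP) (extChartAt IP p) ((extChartAt IP p).symm y) : EP →L[ℝ] EP)
        (fundamentalField IG IP ((extChartAt IP p).symm y) A) := by
  have h := fderiv_actionInChart_inr hπ hx A
  have h0 := mfderiv_extChartAt_symm_self (IP := IG) (1 : G) A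
  rw [h0, extChartAt_to_inv] at h
  have h1 : (extChartAt IP p).symm y <• (1 : G) = (extChartAt IP p).symm y := by simp
  rw [h1] at h
  exact h

theorem fderiv_actionInChart_inr_base (hπ : IsPrincipalBundle (G := G) IG IP IM π) (p : P)
    (A : GroupLieAlgebra IG G) :
    fderiv ℝ (actionInChart IG IP G p) (extChartAt IP p p, extChartAt IG (1 : G) 1) (0, A) =
      fundamentalField IG IP p A := by
  have h := fderiv_actionInChart_inr_one hπ (base_mem_actionDomain p) A
  rw [extChartAt_to_inv, mfderiv_extChartAt_self_apply] at h
  exact h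

end Orbit

/-! ### Horizontal and vertical parts -/

namespace BundleConnection

section Projections

variable {G : Type*} [Group G] [MulAction Gᵐᵒᵖ P]
  [FiniteDimensional ℝ EP] [IsManifold IP (⊤ : ℕ∞) P]

theorem hor_add_ver (C : BundleConnection IP IM G π) (p : P) (v : TangentSpace IP p) :
    C.hor p v + C.ver p v = v :=
  Submodule.projection_add_projection_eq_self (C.isCompl p) v

theorem hor_mem (C : BundleConnection IP IM G π) (p : P) (v : TangentSpace IP p) :
    C.hor p v ∈ C.horizontalSpace p :=
  Submodule.projection_apply_mem (C.isCompl p) v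

theorem ver_of_mem_horizontalSpace (C : BundleConnection IP IM G π) (p : P) {v : TangentSpace IP p}
    (hv : v ∈ C.horizontalSpace p) : C.ver p v = 0 :=
  (Submodule.projection_apply_eq_zero_iff (C.isCompl p).symm).2 hv

theorem ver_of_mem_verticalSpace (C : BundleConnection IP IM G π) (p : P) {v : TangentSpace IP p}
    (hv : v ∈ verticalSpace IP IM π p) : C.ver p v = v :=
  Submodule.projection_apply_of_mem_left (C.isCompl p).symm hv

theorem mfderiv_translation_mem (C : BundleConnection IP IM G π) (p : P) (g : G)
    {v : TangentSpace IP p} (hv : v ∈ C.horizontalSpace p) :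
    mfderiv IP IP (fun q : P ↦ q <• g) p v ∈ C.horizontalSpace (p <• g) := by
  rw [← C.invariant p g]
  exact Submodule.mem_map_of_mem hv

/-- The horizontal projection read in a chart is differentiable. The smoothness of the distribution
concerns the tangent bundle, whose trivialization over the chart at `p` is the derivative of that
chart. -/
theorem differentiableAt_hor_inChart [IP.Boundaryless] (C : BundleConnection IP IM G π) (p : P)
    (v : EP) :
    DifferentiableAt ℝ (fun y : EP ↦
      (mfderiv IP 𝓘(ℝ, EP) (extChartAt IP p) ((extChartAt IP p).symm y) : EP →L[ℝ] EP)
        (C.hor ((extChartAt IP p).symm y)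
          ((mfderiv 𝓘(ℝ, EP) IP (extChartAt IP p).symm y : EP →L[ℝ] EP) v)))
      (extChartAt IP p p) := by
  let e := trivializationAt EP (TangentSpace IP) p
  let σ : EP → TangentBundle IP P := fun y ↦
    e.toOpenPartialHomeomorph.symm ((extChartAt IP p).symm y, v)
  -- `σ` is the vector field with constant coordinates `v`, and `(e (H (σ y))).2` are the coordinates
  -- of its horizontal part.
  let H : TangentBundle IP P → TangentBundle IP P := fun v ↦ ⟨v.proj, C.hor v.proj v.snd⟩
  have hH : ContMDiff IP.tangent IP.tangent (⊤ : ℕ∞) H := C.smooth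
  have h0 : (extChartAt IP p).symm (extChartAt IP p p) = p := extChartAt_to_inv p
  have hb : p ∈ e.baseSet := FiberBundle.mem_baseSet_trivializationAt' p
  have hσ : ContMDiffAt 𝓘(ℝ, EP) IP.tangent (⊤ : ℕ∞) σ (extChartAt IP p p) := by
    have h1 : ContMDiffAt (IP.prod 𝓘(ℝ, EP)) IP.tangent (⊤ : ℕ∞) e.toOpenPartialHomeomorph.symm
        ((extChartAt IP p).symm (extChartAt IP p p), v) := by
      refine (e.contMDiffOn_symm (n := ((⊤ : ℕ∞) : WithTop ℕ∞)) (IB := IP)).contMDiffAt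
        (e.open_target.mem_nhds ?_)
      rw [h0]
      exact e.mem_target.2 hb
    have h2 : ContMDiffAt 𝓘(ℝ, EP) (IP.prod 𝓘(ℝ, EP)) (⊤ : ℕ∞)
        (fun y ↦ ((extChartAt IP p).symm y, v)) (extChartAt IP p p) :=
      (contMDiffAt_extChartAt_symm p (mem_extChartAt_target p)).prodMk contMDiffAt_const
    exact ContMDiffAt.comp (f := fun y ↦ ((extChartAt IP p).symm y, v)) _ h1 h2
  have hproj (y : EP) (hy : (extChartAt IP p).symm y ∈ e.baseSet) :
      σ y = ⟨(extChartAt IP p).symm y, e.symm ((extChartAt IP p).symm y) v⟩ :=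
    (e.mk_symm hy v).symm
  have hse : H (σ (extChartAt IP p p)) ∈ e.source := by
    rw [hproj _ (by rwa [h0])]
    exact e.mem_source.2 (by rwa [h0])
  have he : ContMDiffAt IP.tangent (IP.prod 𝓘(ℝ, EP)) (⊤ : ℕ∞) e (H (σ (extChartAt IP p p))) :=
    (e.contMDiffOn (n := ((⊤ : ℕ∞) : WithTop ℕ∞)) (IB := IP)).contMDiffAt
      (e.open_source.mem_nhds hse)
  have hc : DifferentiableAt ℝ (Prod.snd ∘ e ∘ H ∘ σ) (extChartAt IP p p) := by
    have h1 : ContMDiffAt 𝓘(ℝ, EP) IP.tangent (⊤ : ℕ∞) (H ∘ σ) (extChartAt IP p p) :=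
      hH.contMDiffAt.comp _ hσ
    have h2 : ContMDiffAt 𝓘(ℝ, EP) (IP.prod 𝓘(ℝ, EP)) (⊤ : ℕ∞) (e ∘ H ∘ σ) (extChartAt IP p p) :=
      ContMDiffAt.comp (f := H ∘ σ) _ he h1
    have h3 : ContMDiffAt 𝓘(ℝ, EP) 𝓘(ℝ, EP) (⊤ : ℕ∞) (Prod.snd ∘ e ∘ H ∘ σ) (extChartAt IP p p) :=
      contMDiffAt_snd.comp _ h2
    exact h3.contDiffAt.differentiableAt (by simp)
  refine hc.congr_of_eventuallyEq ?_
  filter_upwards [(isOpen_extChartAt_target p).mem_nhds (mem_extChartAt_target (I := IP) p)]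
    with y hy
  have hys : (extChartAt IP p).symm y ∈ (chartAt HP p).source := by
    rw [← extChartAt_source IP]; exact (extChartAt IP p).map_target hy
  have hyb : (extChartAt IP p).symm y ∈ e.baseSet := hys
  have h2 := TangentBundle.symmL_trivializationAt (I := IP) hys
  have h3 := TangentBundle.continuousLinearMapAt_trivializationAt (I := IP) hys
  rw [IP.range_eq_univ, mfderivWithin_univ, (extChartAt IP p).right_inv hy] at h2
  have h4 : (e.symm ((extChartAt IP p).symm y) v : EP) =
    (mfderiv 𝓘(ℝ, EP) IP (extChartAt IP p).symm y : EP →L[ℝ] EP) v :=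
    (e.symmL_apply (R := ℝ) hyb v).symm.trans (DFunLike.congr_fun h2 v)
  have h5 (w : EP) : (e ⟨(extChartAt IP p).symm y, w⟩).2 =
      (mfderiv IP 𝓘(ℝ, EP) (extChartAt IP p) ((extChartAt IP p).symm y) : EP →L[ℝ] EP) w := by
    rw [← h3]
    exact congrFun (e.coe_linearMapAt_of_mem (R := ℝ) hyb).symm w
  have h6 : H (σ y) = ⟨(extChartAt IP p).symm y, C.hor ((extChartAt IP p).symm y)
      ((mfderiv 𝓘(ℝ, EP) IP (extChartAt IP p).symm y : EP →L[ℝ] EP) v)⟩ := by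
    rw [hproj y hyb]
    exact congrArg (fun w : EP ↦ (⟨(extChartAt IP p).symm y, C.hor ((extChartAt IP p).symm y) w⟩ :
      TangentBundle IP P)) h4
  refine Eq.symm (Eq.trans ?_ (h5 _))
  exact congrArg (fun w ↦ (e w).2) h6

end Projections

/-! ### The connection form -/

section ConnectionForm

variable [MulAction Gᵐᵒᵖ P] [FiniteDimensional ℝ EP] [IsManifold IP (⊤ : ℕ∞) P]
  [LieGroup IG (⊤ : ℕ∞) G] [IsManifold IM (⊤ : ℕ∞) M]

/-- The coordinate expression in the preferred chart at `p` of a one-form with values in the Lie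
algebra of `G`, the latter being regarded as the normed space `EG`. -/
def lieFormInChart (ω : FormOn IP P 1 (GroupLieAlgebra IG G)) (p : P) :
    EP → EP [⋀^Fin 1]→L[ℝ] EG :=
  FormOn.inChart (F := EG) ω p

namespace IsConnectionForm

variable {C : BundleConnection IP IM G π} {ω : FormOn IP P 1 (GroupLieAlgebra IG G)}

theorem apply_fundamentalField (hω : C.IsConnectionForm ω)
    (hπ : IsPrincipalBundle (G := G) IG IP IM π) (p : P) (A : GroupLieAlgebra IG G) :
    ω p ![fundamentalField IG IP p A] = A :=
  hπ.fundamentalField_injective p <| (hω p _).trans <|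
    C.ver_of_mem_verticalSpace p (hπ.fundamentalField_mem_verticalSpace p A)

theorem apply_of_mem_horizontalSpace (hω : C.IsConnectionForm ω)
    (hπ : IsPrincipalBundle (G := G) IG IP IM π) (p : P) {v : TangentSpace IP p}
    (hv : v ∈ C.horizontalSpace p) : ω p ![v] = 0 :=
  hπ.fundamentalField_injective p <| ((hω p _).trans
    (C.ver_of_mem_horizontalSpace p hv)).trans (map_zero _).symm

variable [IG.Boundaryless] [IP.Boundaryless]

theorem lieFormInChart_fderiv_actionInChart_inr_one (hω : C.IsConnectionForm ω)
    (hπ : IsPrincipalBundle (G := G) IG IP IM π) {p : P} {y : EP}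
    (hx : (y, extChartAt IG (1 : G) 1) ∈ actionDomain IG IP G p) (A : GroupLieAlgebra IG G) :
    lieFormInChart ω p (actionInChart IG IP G p (y, extChartAt IG (1 : G) 1))
      ![fderiv ℝ (actionInChart IG IP G p) (y, extChartAt IG (1 : G) 1) (0, A)] = A := by
  rw [fderiv_actionInChart_inr_one hπ hx]
  have h1 : actionInChart IG IP G p (y, extChartAt IG (1 : G) 1) =
      extChartAt IP p ((extChartAt IP p).symm y) := by
    rw [actionInChart, extChartAt_to_inv]; simp
  rw [h1]
  exact (FormOn.inChart_extChartAt_apply (V := EG) ω ((extChartAt IP p).map_target hx.1) _).trans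
    (hω.apply_fundamentalField hπ _ A)

theorem lieFormInChart_fderiv_actionInChart_leftInvariantInChart (hω : C.IsConnectionForm ω)
    (hπ : IsPrincipalBundle (G := G) IG IP IM π) {p : P} {y : EP} {z : EG}
    (hx : (y, z) ∈ actionDomain IG IP G p) (A : GroupLieAlgebra IG G) :
    lieFormInChart ω p (actionInChart IG IP G p (y, z))
      ![fderiv ℝ (actionInChart IG IP G p) (y, z) (0, leftInvariantInChart IG G A z)] = A := by
  rw [fderiv_actionInChart_inr hπ hx, mfderiv_extChartAt_symm_leftInvariantInChart A hx.2.1,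
    hπ.mfderiv_orbitMap_mulInvariantVectorField]
  exact (FormOn.inChart_extChartAt_apply (V := EG) ω hx.2.2 _).trans
    (hω.apply_fundamentalField hπ _ A)

/-- Right translates of horizontal vectors are horizontal, by the invariance of the connection. -/
theorem lieFormInChart_fderiv_actionInChart_inl_of_mem_horizontalSpace (hω : C.IsConnectionForm ω)
    (hπ : IsPrincipalBundle (G := G) IG IP IM π) {p : P} {z : EG}
    (hx : (extChartAt IP p p, z) ∈ actionDomain IG IP G p) {v : TangentSpace IP p}
    (hv : v ∈ C.horizontalSpace p) :
    lieFormInChart ω p (actionInChart IG IP G p (extChartAt IP p p, z))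
      ![fderiv ℝ (actionInChart IG IP G p) (extChartAt IP p p, z) ((v : EP), (0 : EG))] = 0 := by
  have h := fderiv_actionInChart_inl hπ hx v
  have h0 := mfderiv_extChartAt_symm_self (IP := IP) p v
  rw [h0] at h
  rw [h]
  refine (FormOn.inChart_extChartAt_apply (V := EG) ω hx.2.2 _).trans ?_
  refine hω.apply_of_mem_horizontalSpace hπ _ ?_
  rw [extChartAt_to_inv]
  exact C.mfderiv_translation_mem p _ hv

variable [FiniteDimensional ℝ EG]

/-- Fundamental vector fields and vertical parts of coordinate fields both depend smoothly on the base
point, so the equation `A♯ = Ver(v)` defining `A = ω(v)` can be solved smoothly. -/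
theorem differentiableAt_lieFormInChart (hω : C.IsConnectionForm ω)
    (hπ : IsPrincipalBundle (G := G) IG IP IM π) (p : P) :
    DifferentiableAt ℝ (lieFormInChart ω p) (extChartAt IP p p) := by
  let x := extChartAt IP p p
  let z := extChartAt IG (1 : G) 1
  let K : EP → EG →L[ℝ] EP := fun y ↦
    fderiv ℝ (actionInChart IG IP G p) (y, z) ∘L ContinuousLinearMap.inr ℝ EP EG
  let S : EP → EP → EP := fun y v ↦
    (mfderiv IP 𝓘(ℝ, EP) (extChartAt IP p) ((extChartAt IP p).symm y) : EP →L[ℝ] EP)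
      (C.hor ((extChartAt IP p).symm y)
        ((mfderiv 𝓘(ℝ, EP) IP (extChartAt IP p).symm y : EP →L[ℝ] EP) v))
  have hF : ContDiffAt ℝ (⊤ : ℕ∞) (actionInChart IG IP G p) (x, z) :=
    contDiffAt_actionInChart hπ (base_mem_actionDomain p)
  have hK : DifferentiableAt ℝ K x := by
    have h1 : DifferentiableAt ℝ (fderiv ℝ (actionInChart IG IP G p)) (x, z) :=
      (hF.fderiv_right (m := 1) (by norm_cast)).differentiableAt (by simp)
    have h2 : DifferentiableAt ℝ (fun y ↦ fderiv ℝ (actionInChart IG IP G p) (y, z)) x :=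
      DifferentiableAt.fun_comp' (f := fun y ↦ (y, z)) x h1
        (hasFDerivAt_prodMk_left x z).differentiableAt
    exact h2.clm_comp (differentiableAt_const _)
  have hinj : Function.Injective (K x) := by
    intro A B hAB
    refine hπ.fundamentalField_injective p ?_
    exact (fderiv_actionInChart_inr_base hπ p A).symm.trans
      (Eq.trans hAB (fderiv_actionInChart_inr_base hπ p B))
  refine differentiableAt_oneForm_of_comp_eq (K := K) (T := fun y v ↦ v - S y v) hK hinj
    (fun v ↦ (differentiableAt_const v).sub (C.differentiableAt_hor_inChart p v)) ?_
  filter_upwards [eventually_left_mem_actionDomain hπ p] with y hy v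
  let q := (extChartAt IP p).symm y
  let w : TangentSpace IP q := (mfderiv 𝓘(ℝ, EP) IP (extChartAt IP p).symm y : EP →L[ℝ] EP) v
  have h1 : lieFormInChart ω p y ![v] = ω q ![w] := by
    refine congrArg (ω q : EP [⋀^Fin 1]→L[ℝ] EG) ?_
    ext i; fin_cases i; rfl
  have h2 : K y (ω q ![w]) =
      (mfderiv IP 𝓘(ℝ, EP) (extChartAt IP p) q : EP →L[ℝ] EP) (fundamentalField IG IP q (ω q ![w])) :=
    fderiv_actionInChart_inr_one hπ hy _
  have h3 : (mfderiv IP 𝓘(ℝ, EP) (extChartAt IP p) q : EP →L[ℝ] EP) w = v := by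
    have h := mfderiv_extChartAt_comp_mfderivWithin_extChartAt_symm (I := IP) hy.1
    rw [IP.range_eq_univ, mfderivWithin_univ] at h
    exact DFunLike.congr_fun h v
  have h4 : C.ver q w = w - C.hor q w := eq_sub_of_add_eq' (C.hor_add_ver q w)
  rw [h1, h2, hω q w, h4]
  refine ((mfderiv IP 𝓘(ℝ, EP) (extChartAt IP p) q : EP →L[ℝ] EP).map_sub w (C.hor q w)).trans ?_
  rw [h3]
  rfl

/-- The form `dω` vanishes on a horizontal and a fundamental vector, as the contracted forms are
constant along the two families of coordinate lines of the action: `ω(A♯) = A` everywhere, and `ω`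
vanishes on the right translates of a horizontal vector. -/
theorem extDeriv_lieFormInChart_horizontal_fundamentalField (hω : C.IsConnectionForm ω)
    (hπ : IsPrincipalBundle (G := G) IG IP IM π) (p : P) {v : TangentSpace IP p}
    (hv : v ∈ C.horizontalSpace p) (A : GroupLieAlgebra IG G) :
    extDeriv (lieFormInChart ω p) (extChartAt IP p p)
      ![(v : EP), (fundamentalField IG IP p A : EP)] = 0 := by
  have h := extDeriv_apply_fderiv_prod (η := lieFormInChart ω p)
    (F := actionInChart IG IP G p) (x := extChartAt IP p p) (z := extChartAt IG (1 : G) 1)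
    (u := v) (w := A) (a := 0) (b := A)
    (by rw [actionInChart_base]; exact hω.differentiableAt_lieFormInChart hπ p)
    ((contDiffAt_actionInChart hπ (base_mem_actionDomain p)).of_le (by norm_cast))
    ((eventually_right_mem_actionDomain hπ p).mono fun z hz ↦
      hω.lieFormInChart_fderiv_actionInChart_inl_of_mem_horizontalSpace hπ hz hv)
    ((eventually_left_mem_actionDomain hπ p).mono fun y hy ↦
      hω.lieFormInChart_fderiv_actionInChart_inr_one hπ hy A)
  have hv' := fderiv_actionInChart_inl_base hπ p v
  rw [actionInChart_base, fderiv_actionInChart_inr_base hπ, hv'] at h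
  exact h

/-- The restriction of `ω` to an orbit is the Maurer–Cartan form of `G`, so that this is the
Maurer–Cartan equation. -/
theorem extDeriv_lieFormInChart_fundamentalField (hω : C.IsConnectionForm ω)
    (hπ : IsPrincipalBundle (G := G) IG IP IM π) (p : P) (A B : GroupLieAlgebra IG G) :
    extDeriv (lieFormInChart ω p) (extChartAt IP p p)
      ![(fundamentalField IG IP p A : EP), (fundamentalField IG IP p B : EP)] = -⁅A, B⁆ := by
  let x := extChartAt IP p p
  let z := extChartAt IG (1 : G) 1
  let f : EG → EP := fun z ↦ actionInChart IG IP G p (x, z)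
  have hfz : f z = x := actionInChart_base p
  have hF : ContDiffAt ℝ (⊤ : ℕ∞) (actionInChart IG IP G p) (x, z) :=
    contDiffAt_actionInChart hπ (base_mem_actionDomain p)
  have hf : ContDiffAt ℝ 2 f z :=
    (hF.of_le (by norm_cast)).comp z (contDiffAt_const.prodMk contDiffAt_id)
  have hdf (t : EG) (ht : (x, t) ∈ actionDomain IG IP G p) (w : EG) :
      fderiv ℝ f t w = fderiv ℝ (actionInChart IG IP G p) (x, t) (0, w) := by
    have h := ((contDiffAt_actionInChart hπ ht).differentiableAt (by simp)).hasFDerivAt.comp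
      (f := fun t ↦ (x, t)) t (hasFDerivAt_prodMk_right x t)
    exact DFunLike.congr_fun h.fderiv w
  have hconst (A : GroupLieAlgebra IG G) : ∀ᶠ t in 𝓝 z, lieFormInChart ω p (f t)
      ![fderiv ℝ f t (leftInvariantInChart IG G A t)] = A := by
    filter_upwards [eventually_right_mem_actionDomain hπ p] with t ht
    rw [hdf t ht]
    exact hω.lieFormInChart_fderiv_actionInChart_leftInvariantInChart hπ ht A
  have h := extDeriv_apply_fderiv_of_const (η := lieFormInChart ω p) (f := f) (x := z)
    (by rw [hfz]; exact hω.differentiableAt_lieFormInChart hπ p) hf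
    (differentiableAt_leftInvariantInChart A) (differentiableAt_leftInvariantInChart B)
    (hconst A) (hconst B)
  have hz := base_mem_actionDomain (IG := IG) (IP := IP) (G := G) p
  have hbase (A : GroupLieAlgebra IG G) :
      fderiv ℝ f z A = fundamentalField IG IP p A :=
    (hdf z hz A).trans (fderiv_actionInChart_inr_base hπ p A)
  rw [← bracket_eq_lieBracket_leftInvariantInChart, leftInvariantInChart_self,
    leftInvariantInChart_self, hbase, hbase] at h
  rw [hfz] at h
  refine h.trans (congrArg Neg.neg ?_)
  have h2 := hω.lieFormInChart_fderiv_actionInChart_inr_one hπ hz ⁅A, B⁆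
  rw [actionInChart_base] at h2
  have h3 := hdf z hz (⁅A, B⁆ : GroupLieAlgebra IG G)
  rw [h3]
  exact h2

end IsConnectionForm

end ConnectionForm

end BundleConnection

end Bundle

end

/-! ### The structure equation -/

theorem mainTheorem8 {EG HG EP HP EM HM : Type*}
    [NormedAddCommGroup EG] [NormedSpace ℝ EG] [FiniteDimensional ℝ EG] [TopologicalSpace HG]
    [NormedAddCommGroup EP] [NormedSpace ℝ EP] [FiniteDimensional ℝ EP] [TopologicalSpace HP]
    [NormedAddCommGroup EM] [NormedSpace ℝ EM] [FiniteDimensional ℝ EM] [TopologicalSpace HM]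
    (IG : ModelWithCorners ℝ EG HG) (IP : ModelWithCorners ℝ EP HP) (IM : ModelWithCorners ℝ EM HM)
    [IG.Boundaryless] [IP.Boundaryless] [IM.Boundaryless]
    {G P M : Type*}
    [TopologicalSpace G] [ChartedSpace HG G] [Group G] [LieGroup IG (⊤ : ℕ∞) G]
    [TopologicalSpace P] [ChartedSpace HP P] [IsManifold IP (⊤ : ℕ∞) P] [MulAction Gᵐᵒᵖ P]
    [TopologicalSpace M] [ChartedSpace HM M] [IsManifold IM (⊤ : ℕ∞) M]
    (π : P → M) (hπ : IsPrincipalBundle (G := G) IG IP IM π)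
    (C : BundleConnection IP IM G π)
    (ω : FormOn IP P 1 (GroupLieAlgebra IG G)) (hω : C.IsConnectionForm ω) :
    C.curvature ω = lieD ω + selfWedge ω := by
  funext p
  let Φ : EP [⋀^Fin 2]→L[ℝ] EG := extDeriv (BundleConnection.lieFormInChart ω p) (extChartAt IP p p)
  -- In the preferred chart at `p` the derivative of the chart at `p` is the identity.
  have hd (X : Fin 2 → TangentSpace IP p) : lieD ω p X = Φ ![X 0, X 1] := by
    refine congrArg Φ ?_
    ext i
    fin_cases i
    · exact mfderiv_extChartAt_self_apply p (X 0)
    · exact mfderiv_extChartAt_self_apply p (X 1)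
  ext X
  have hcurv : C.curvature ω p X = Φ ![C.hor p (X 0), C.hor p (X 1)] := hd fun i ↦ C.hor p (X i)
  have hsum : (lieD ω + selfWedge ω) p X = lieD ω p X + ⁅ω p ![X 0], ω p ![X 1]⁆ := rfl
  rw [hcurv, hsum, hd]
  -- Expand `dω` along the decompositions `X i = h i + v i`, where `v i` is a fundamental vector.
  let x : Fin 2 → EP := X
  let h : Fin 2 → EP := fun i ↦ C.hor p (X i)
  let v : Fin 2 → EP := fun i ↦ fundamentalField IG IP p (ω p ![X i])
  let β : EG := (⁅ω p ![X 0], ω p ![X 1]⁆ : GroupLieAlgebra IG G)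
  have hx (i : Fin 2) : h i + v i = x i :=
    (congrArg (h i + ·) (hω p (X i))).trans (C.hor_add_ver p (X i))
  have hvv : Φ ![v 0, v 1] = -β :=
    hω.extDeriv_lieFormInChart_fundamentalField hπ p (ω p ![X 0]) (ω p ![X 1])
  have hhv (i j : Fin 2) : Φ ![h i, v j] = 0 :=
    hω.extDeriv_lieFormInChart_horizontal_fundamentalField hπ p (C.hor_mem p (X i)) (ω p ![X j])
  have key := Φ.apply_add_add (h 0) (v 0) (h 1) (v 1)
  rw [hx, hx, hvv, hhv, hhv] at key
  have : Φ ![h 0, h 1] = Φ ![x 0, x 1] + β := by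
    rw [key]; abel
  exact this
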